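/- Let $T(x)=\sum_{n=0}^\infty 2^{-n}\phi(2^n x)$, where $\phi(x)=\operatorname{dist}(x,\mathbb{Z})$, be the Takagi function on $[0,1]$, and for $y\in\mathbb{R}$ let $L(y)=\{x\in[0,1]:T(x)=y\}$. For $x\in[0,1)$ with binary expansion $x=\sum_{n\ge 1}\varepsilon_n 2^{-n}$, $\varepsilon_n\in\{0,1\}$ (the one ending in all zeros if $x$ is a dyadic rational), put $D_k(x)=\sum_{j=1}^k(-1)^{\varepsilon_j}$ for $k \ge 0$. The local level set containing $x\in[0,1)$ is $L_x^{loc}=\{x'\in[0,1): |D_j(x')|=|D_j(x)|\text{ for all } j\in\mathbb{N}\}$. The range $T([0,1])$ of $T$ is $[0,\frac23]$, and the set $$S_\infty^{loc,uc}=\{y: L(y)\text{ contains uncountably many distinct local level sets}\}$$ is residual in the range of $T$; that is, $S_\infty^{loc,uc}\cap[0,\frac23]$ contains a countable intersection of dense (relatively) open subsets of $[0,\frac23]$. -/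

import Mathlib

namespace Takagi

/-- The distance from `x` to the nearest integer. -/
noncomputable def phi (x : ℝ) : ℝ :=
  Metric.infDist x (Set.range (Int.cast : ℤ → ℝ))

/-- Takagi's function `T(x) = ∑_{n ≥ 0} 2⁻ⁿ φ(2ⁿ x)`. The series converges absolutely for every
real `x`, since `0 ≤ φ ≤ 1/2`. -/
noncomputable def T (x : ℝ) : ℝ :=
  ∑' n : ℕ, (1 / 2 ^ n : ℝ) * phi (2 ^ n * x)

/-- The range of `T` on the unit interval. -/
def rangeT : Set ℝ := T '' Set.Icc 0 1

/-- The level set `L(y) = {x ∈ [0,1] : T(x) = y}`. -/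
def levelSet (y : ℝ) : Set ℝ := {x | x ∈ Set.Icc (0 : ℝ) 1 ∧ T x = y}

/-- `D_k(x) = ∑_{j=1}^k (-1)^{ε_j}`, where `x = 0.ε₁ε₂…` is the binary expansion of `x ∈ [0,1)`,
ending in all zeros if `x` is dyadic. Here `Real.digits x 2 i = ⌊2^(i+1) x⌋ mod 2` is `ε_{i+1}`. -/
noncomputable def D (k : ℕ) (x : ℝ) : ℤ :=
  ∑ i ∈ Finset.range k, (-1 : ℤ) ^ (Real.digits x 2 i : ℕ)

/-- The equivalence relation `x ∼ x'` (used for points of `[0,1)`): `|D_j(x)| = |D_j(x')|` for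
each `j`. -/
def Equivalent (x x' : ℝ) : Prop := ∀ j : ℕ, |D j x| = |D j x'|

/-- The local level set containing `x ∈ [0,1)`. -/
def localLevelSet (x : ℝ) : Set ℝ := {x' | x' ∈ Set.Ico (0 : ℝ) 1 ∧ Equivalent x' x}

/-- The collection of all (distinct) local level sets contained in `L(y)`. -/
def localLevelSetsIn (y : ℝ) : Set (Set ℝ) :=
  {A | (∃ x ∈ Set.Ico (0 : ℝ) 1, A = localLevelSet x) ∧ A ⊆ levelSet y}

/-- The set of levels `y` such that `L(y)` contains uncountably many distinct local level sets. -/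
def SLocUc : Set ℝ := {y | ¬ (localLevelSetsIn y).Countable}

end Takagi

/-!
The idea is that generic levels are shared, at every scale, by humps of the graph of `T` that carry
different local level sets.

If the first `n` binary digits of a dyadic interval are balanced (`D n = 0`), then over this
interval the graph of `T` is a copy, scaled by `2⁻ⁿ`, of the whole graph (`Hump.T_point`). Since any
finite sequence of digits can be completed to a balanced one and `T` is continuous, every nonempty
open set of levels contains the whole range of some hump (`exists_hump_levels_subset`). Now the two
balanced sequences `01` and `0011` give the points `1 / 4` and `3 / 16`, at both of which `T` has
the value `1 / 2`, so the ranges of the two humps overlap in `(1 / 2, 13 / 24)`; but no point of the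
first hump is equivalent to a point of the second, as `D 2` is `0` on one and `2` on the other. By
self-similarity every hump `g` contains such a pair, whose common levels form an open interval
`g.core`, and the levels that are either missed by a hump `h` or belong to the core of a hump
inside `h` form a dense open set `splitting h`. There are only countably many humps.

Let `y` lie in all the sets `splitting h`. Given any sequence of points `z i`, nested humps whose
ranges contain `y` are chosen so that the `i`-th choice between two inequivalent humps avoids the
class of `z i`. By compactness they have a common point `x`, which satisfies `T x = y` and is
equivalent to no `z i` (`exists_T_eq_forall_not_equivalent`). Moreover `T` is constant on local
level sets, since expanding `T` along the binary digits leaves a series in the squares `(D j) ^ 2`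
only (`T_expansion`, `T_eq_of_equivalent`). Hence the local level sets in `L(y)` cannot be
enumerated.
-/

namespace Takagi

/-! ### The Takagi function and its functional equation -/

lemma phi_nonneg (x : ℝ) : 0 ≤ phi x := Metric.infDist_nonneg

lemma phi_le_abs_sub (x : ℝ) (m : ℤ) : phi x ≤ |x - m| :=
  Metric.infDist_le_dist_of_mem (Set.mem_range_self m)

lemma le_phi {x d : ℝ} (h : ∀ m : ℤ, d ≤ |x - m|) : d ≤ phi x := by
  refine (Metric.le_infDist (Set.range_nonempty _)).2 ?_
  rintro _ ⟨m, rfl⟩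
  exact h m

lemma phi_add_nat (x : ℝ) (k : ℕ) : phi (k + x) = phi x := by
  apply le_antisymm
  · refine le_phi fun m => ?_
    have := phi_le_abs_sub (k + x) (k + m)
    push_cast at this
    rwa [add_sub_add_left_eq_sub] at this
  · refine le_phi fun m => ?_
    have := phi_le_abs_sub x (m - k)
    push_cast at this
    convert this using 2
    ring

lemma phi_eq_min {x : ℝ} (h0 : 0 ≤ x) (h1 : x ≤ 1) : phi x = min x (1 - x) := by
  apply le_antisymm
  · apply le_min
    · simpa [abs_of_nonneg h0] using phi_le_abs_sub x 0
    · simpa [abs_sub_comm x 1, abs_of_nonneg (sub_nonneg.2 h1)] using phi_le_abs_sub x 1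
  · refine le_phi fun m => ?_
    rcases le_or_gt m 0 with hm | hm
    · have : (m : ℝ) ≤ 0 := by exact_mod_cast hm
      exact (min_le_left _ _).trans (by linarith [le_abs_self (x - m)])
    · have : (1 : ℝ) ≤ m := by exact_mod_cast hm
      exact (min_le_right _ _).trans (by linarith [neg_abs_le (x - m)])

lemma phi_of_le_half {x : ℝ} (h0 : 0 ≤ x) (h1 : x ≤ 1 / 2) : phi x = x := by
  rw [phi_eq_min h0 (by linarith), min_eq_left (by linarith)]

lemma phi_of_half_le {x : ℝ} (h0 : 1 / 2 ≤ x) (h1 : x ≤ 1) : phi x = 1 - x := by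
  rw [phi_eq_min (by linarith) h1, min_eq_right (by linarith)]

lemma phi_le_half (x : ℝ) : phi x ≤ 1 / 2 :=
  (phi_le_abs_sub x (round x)).trans (abs_sub_round x)

lemma continuous_phi : Continuous phi := Metric.continuous_infDist_pt _

lemma T_term_nonneg (x : ℝ) (n : ℕ) : 0 ≤ (1 / 2 ^ n : ℝ) * phi (2 ^ n * x) :=
  mul_nonneg (by positivity) (phi_nonneg _)

lemma T_term_le (x : ℝ) (n : ℕ) :
    (1 / 2 ^ n : ℝ) * phi (2 ^ n * x) ≤ (1 / 2) * (1 / 2) ^ n := by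
  rw [one_div_pow, mul_comm (1 / 2 : ℝ)]
  exact mul_le_mul_of_nonneg_left (phi_le_half _) (by positivity)

lemma summable_T_bound : Summable fun n : ℕ => (1 / 2 : ℝ) * (1 / 2) ^ n :=
  summable_geometric_two.mul_left _

lemma summable_T (x : ℝ) : Summable fun n : ℕ => (1 / 2 ^ n : ℝ) * phi (2 ^ n * x) :=
  Summable.of_nonneg_of_le (T_term_nonneg x) (T_term_le x) summable_T_bound

lemma continuous_T : Continuous T := by
  refine continuous_tsum (fun n => ?_) summable_T_bound fun n x => ?_
  · exact continuous_const.mul (continuous_phi.comp (continuous_const.mul continuous_id))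
  · rw [Real.norm_of_nonneg (T_term_nonneg x n)]
    exact T_term_le x n

lemma T_nonneg (x : ℝ) : 0 ≤ T x := tsum_nonneg (T_term_nonneg x)

lemma T_le_one (x : ℝ) : T x ≤ 1 := by
  refine ((summable_T x).tsum_le_tsum (T_term_le x) summable_T_bound).trans ?_
  rw [tsum_mul_left, tsum_geometric_two]
  norm_num

lemma T_eq_phi_add (x : ℝ) : T x = phi x + T (2 * x) / 2 := by
  unfold T
  rw [(summable_T x).tsum_eq_zero_add, ← tsum_div_const]
  congr 1
  · simp
  · refine tsum_congr fun n => ?_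
    rw [pow_succ, ← mul_assoc]
    field_simp

lemma T_add_nat (x : ℝ) (k : ℕ) : T (k + x) = T x := by
  unfold T
  refine tsum_congr fun n => ?_
  have : (2 : ℝ) ^ n * (k + x) = ((2 ^ n * k : ℕ) : ℝ) + 2 ^ n * x := by push_cast; ring
  rw [this, phi_add_nat]

lemma T_zero : T 0 = 0 := by
  have h := T_eq_phi_add 0
  rw [phi_of_le_half le_rfl (by norm_num), mul_zero] at h
  linarith

lemma T_one_half : T (1 / 2) = 1 / 2 := by
  have h := T_eq_phi_add (1 / 2)
  have h1 := T_add_nat 0 1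
  rw [phi_of_le_half (by norm_num) le_rfl] at h
  norm_num [T_zero] at h h1 ⊢
  rw [h, h1]
  norm_num

lemma T_one_quarter : T (1 / 4) = 1 / 2 := by
  have h := T_eq_phi_add (1 / 4)
  rw [phi_of_le_half (by norm_num) (by norm_num), show (2 : ℝ) * (1 / 4) = 1 / 2 by norm_num,
    T_one_half] at h
  rw [h]; norm_num

lemma T_three_sixteenths : T (3 / 16) = 1 / 2 := by
  have h := T_eq_phi_add (3 / 16)
  have h1 := T_eq_phi_add (3 / 8)
  have h2 := T_eq_phi_add (3 / 4)
  have h3 := T_add_nat (1 / 2) 1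
  rw [phi_of_le_half (by norm_num) (by norm_num), show (2 : ℝ) * (3 / 16) = 3 / 8 by norm_num]
    at h
  rw [phi_of_le_half (by norm_num) (by norm_num), show (2 : ℝ) * (3 / 8) = 3 / 4 by norm_num]
    at h1
  rw [phi_of_half_le (by norm_num) (by norm_num),
    show (2 : ℝ) * (3 / 4) = (1 : ℕ) + 1 / 2 by norm_num, h3, T_one_half] at h2
  linarith

lemma T_one_third : T (1 / 3) = 2 / 3 := by
  have h := T_eq_phi_add (1 / 3)
  have h1 := T_eq_phi_add (2 / 3)
  have h2 := T_add_nat (1 / 3) 1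
  rw [phi_of_le_half (by norm_num) (by norm_num), show (2 : ℝ) * (1 / 3) = 2 / 3 by norm_num]
    at h
  rw [phi_of_half_le (by norm_num) (by norm_num),
    show (2 : ℝ) * (2 / 3) = (1 : ℕ) + 1 / 3 by norm_num, h2] at h1
  linarith

lemma phi_add_half_phi_le (x : ℝ) : phi x + phi (2 * x) / 2 ≤ 1 / 2 := by
  -- With `m` the floor of `x`, the function `φ (2 * ·)` is at most the distance to `2 * m + 1`.
  have h0 := phi_le_abs_sub x ⌊x⌋
  have h1 := phi_le_abs_sub x (⌊x⌋ + 1)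
  have h2 := phi_le_abs_sub (2 * x) (2 * ⌊x⌋ + 1)
  have hl := Int.floor_le x
  have hu := Int.lt_floor_add_one x
  push_cast at h1 h2
  rw [abs_of_nonneg (by linarith)] at h0
  rw [abs_of_nonpos (by linarith)] at h1
  rcases abs_cases (2 * x - (2 * (⌊x⌋ : ℝ) + 1)) with h | h <;> linarith

lemma T_le (x : ℝ) : T x ≤ 2 / 3 := by
  have hstep : ∀ n : ℕ, ∀ x, T x ≤ 2 / 3 + (1 / 4) ^ n := by
    intro n
    induction n with
    | zero => intro x; linarith [T_le_one x, pow_zero (1 / 4 : ℝ)]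
    | succ n ih =>
      intro x
      have h1 := T_eq_phi_add x
      have h2 := T_eq_phi_add (2 * x)
      have h3 := phi_add_half_phi_le x
      have h4 := ih (2 * (2 * x))
      rw [pow_succ]
      linarith
  have hlim : Filter.Tendsto (fun n : ℕ => (2 / 3 : ℝ) + (1 / 4) ^ n) Filter.atTop
      (nhds (2 / 3 + 0)) :=
    tendsto_const_nhds.add (tendsto_pow_atTop_nhds_zero_of_lt_one (by norm_num) (by norm_num))
  rw [add_zero] at hlim
  exact ge_of_tendsto' hlim fun n => hstep n x

/-- `T` attains its maximum at `1 / 3`, so it already maps `[0, 1 / 3]` onto `[0, 2 / 3]`. -/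
lemma exists_T_eq {y : ℝ} (hy : y ∈ Set.Icc (0 : ℝ) (2 / 3)) :
    ∃ t ∈ Set.Ico (0 : ℝ) 1, T t = y := by
  have h := intermediate_value_Icc (show (0 : ℝ) ≤ 1 / 3 by norm_num) continuous_T.continuousOn
  rw [T_zero, T_one_third] at h
  obtain ⟨t, ht, rfl⟩ := h hy
  exact ⟨t, ⟨ht.1, by linarith [ht.2]⟩, rfl⟩

lemma rangeT_eq : rangeT = Set.Icc 0 (2 / 3) := by
  apply Set.Subset.antisymm
  · rintro _ ⟨x, -, rfl⟩
    exact ⟨T_nonneg x, T_le x⟩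
  · intro y hy
    obtain ⟨t, ht, rfl⟩ := exists_T_eq hy
    exact ⟨t, Set.Ico_subset_Icc_self ht, rfl⟩

/-! ### Binary digits and the self-similarity of the graph -/

lemma digits_val (x : ℝ) (i : ℕ) : (Real.digits x 2 i : ℕ) = ⌊x * 2 ^ (i + 1)⌋₊ % 2 := by
  simp [Real.digits, Fin.ofNat]

lemma D_zero (x : ℝ) : D 0 x = 0 := by simp [D]

/-- The first `n` digits of `(k + t) / 2 ^ n`, where `0 ≤ t < 1`, do not depend on `t`. -/
lemma D_eq_of_le {j n : ℕ} (hj : j ≤ n) (k : ℕ) {t : ℝ} (ht : t ∈ Set.Ico (0 : ℝ) 1) :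
    D j ((k + t) / 2 ^ n) = D j (k / 2 ^ n) := by
  have key : ∀ s ∈ Set.Ico (0 : ℝ) 1, ∀ i < j,
      (Real.digits ((k + s) / 2 ^ n) 2 i : ℕ) = k / 2 ^ (n - (i + 1)) % 2 := by
    intro s hs i hi
    have : ((k : ℝ) + s) / 2 ^ n * 2 ^ (i + 1) = (k + s) / ((2 ^ (n - (i + 1)) : ℕ) : ℝ) := by
      rw [Nat.cast_pow, Nat.cast_ofNat, div_mul_eq_mul_div, div_eq_div_iff (by positivity)
        (by positivity), mul_assoc, ← pow_add]
      congr 2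
      omega
    have hfl : ⌊(k : ℝ) + s⌋₊ = k := by
      rw [Nat.floor_eq_iff (by linarith [hs.1, Nat.cast_nonneg (α := ℝ) k])]
      exact ⟨by linarith [hs.1], by linarith [hs.2]⟩
    rw [digits_val, this, Nat.floor_div_natCast, hfl]
  refine Finset.sum_congr rfl fun i hi => ?_
  have h0 := key 0 ⟨le_rfl, one_pos⟩ i (Finset.mem_range.1 hi)
  rw [add_zero] at h0
  rw [key t ht i (Finset.mem_range.1 hi), h0]

lemma D_add (n l k : ℕ) {t : ℝ} (ht : t ∈ Set.Ico (0 : ℝ) 1) :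
    D (n + l) ((k + t) / 2 ^ n) = D n (k / 2 ^ n) + D l t := by
  rw [← D_eq_of_le le_rfl k ht]
  unfold D
  rw [Finset.sum_range_add]
  congr 1
  refine Finset.sum_congr rfl fun i _ => ?_
  congr 1
  have : ((k : ℝ) + t) / 2 ^ n * 2 ^ (n + i + 1) =
      t * 2 ^ (i + 1) + ((2 * (k * 2 ^ i) : ℕ) : ℝ) := by
    push_cast
    rw [add_assoc n, pow_add]
    field_simp
    ring
  rw [digits_val, digits_val, this, Nat.floor_add_natCast (mul_nonneg ht.1 (by positivity))]
  omega

lemma D_one_of_lt {t : ℝ} (h1 : t < 1 / 2) : D 1 t = 1 := by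
  have : ⌊t * 2⌋₊ = 0 := Nat.floor_eq_zero.2 (by linarith)
  simp [D, digits_val, this]

lemma D_one_of_le {t : ℝ} (h0 : 1 / 2 ≤ t) (h1 : t < 1) : D 1 t = -1 := by
  have : ⌊t * 2⌋₊ = 1 := by
    rw [Nat.floor_eq_iff (by linarith)]
    constructor <;> push_cast <;> linarith
  simp [D, digits_val, this]

/-- Every value of `T` is expanded along the first `n` binary digits. The sum only involves
the squares of the numbers `D j`: since `D (j + 1) = D j ± 1`, the product `D j * D (j + 1)` is a
function of these squares. -/
lemma T_expansion (n k : ℕ) {t : ℝ} (ht : t ∈ Set.Ico (0 : ℝ) 1) :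
    T ((k + t) / 2 ^ n) =
      ∑ j ∈ Finset.range n, ((D j (k / 2 ^ n) : ℝ) ^ 2 - (D (j + 1) (k / 2 ^ n) : ℝ) ^ 2 + 3) /
        2 ^ (j + 3) + (D n (k / 2 ^ n) * (t - 1 / 2) + T t) / 2 ^ n := by
  induction n generalizing k t with
  | zero => simp [D_zero, T_add_nat]
  | succ n ih =>
    -- The last digit `e` of `k` is moved over to the tail `t`.
    obtain ⟨q, e, he, rfl⟩ : ∃ q e : ℕ, e < 2 ∧ k = 2 * q + e :=
      ⟨k / 2, k % 2, Nat.mod_lt _ two_pos, (Nat.div_add_mod k 2).symm⟩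
    have hshift : ∀ s : ℝ,
        (((2 * q + e : ℕ) : ℝ) + s) / 2 ^ (n + 1) = (q + (e + s) / 2) / 2 ^ n := by
      intro s
      push_cast
      rw [pow_succ]
      field_simp
      ring
    have hs : ∀ s ∈ Set.Ico (0 : ℝ) 1, ((e : ℝ) + s) / 2 ∈ Set.Ico (0 : ℝ) 1 := by
      intro s hs
      have h1 : (e : ℝ) ≤ 1 := by exact_mod_cast Nat.le_of_lt_succ he
      have h0 : (0 : ℝ) ≤ e := e.cast_nonneg
      exact ⟨by linarith [hs.1], by linarith [hs.2]⟩
    have h00 : (0 : ℝ) ∈ Set.Ico (0 : ℝ) 1 := ⟨le_rfl, one_pos⟩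
    have hbase := hshift 0
    rw [add_zero] at hbase
    have hD : ∀ j ≤ n, D j (((2 * q + e : ℕ) : ℝ) / 2 ^ (n + 1)) = D j (q / 2 ^ n) := by
      intro j hj
      rw [hbase]
      exact D_eq_of_le hj q (hs 0 h00)
    have hD1 : D (n + 1) (((2 * q + e : ℕ) : ℝ) / 2 ^ (n + 1)) =
        D n (q / 2 ^ n) + D 1 ((e + 0) / 2) := by
      rw [hbase]
      exact D_add n 1 q (hs 0 h00)
    have hT : T ((e + t) / 2) = phi ((e + t) / 2) + T t / 2 := by
      rw [T_eq_phi_add, mul_div_cancel₀ _ two_ne_zero, T_add_nat]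
    rw [hshift t, ih q (hs t ht), Finset.sum_range_succ, hD1, hD n le_rfl, hT]
    have hsum : ∑ j ∈ Finset.range n, ((D j (q / 2 ^ n) : ℝ) ^ 2 -
          (D (j + 1) (q / 2 ^ n) : ℝ) ^ 2 + 3) / 2 ^ (j + 3) =
        ∑ j ∈ Finset.range n, ((D j (((2 * q + e : ℕ) : ℝ) / 2 ^ (n + 1)) : ℝ) ^ 2 -
          (D (j + 1) (((2 * q + e : ℕ) : ℝ) / 2 ^ (n + 1)) : ℝ) ^ 2 + 3) / 2 ^ (j + 3) := by
      refine Finset.sum_congr rfl fun j hj => ?_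
      have := Finset.mem_range.1 hj
      rw [hD j (by omega), hD (j + 1) (by omega)]
    rw [hsum, add_assoc]
    congr 1
    obtain ⟨t0, t1⟩ := ht
    interval_cases e
    · rw [D_one_of_lt (by norm_num), phi_of_le_half (by norm_num; linarith)
        (by norm_num; linarith)]
      push_cast
      field_simp
      ring
    · rw [D_one_of_le (by norm_num) (by norm_num), phi_of_half_le (by norm_num; linarith)
        (by norm_num; linarith)]
      push_cast
      field_simp
      ring

lemma abs_D_le (n : ℕ) (x : ℝ) : |D n x| ≤ n := by
  refine (Finset.abs_sum_le_sum_abs _ _).trans ?_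
  simp [abs_pow]

lemma exists_eq_add_div_two_pow (n : ℕ) {x : ℝ} (hx : 0 ≤ x) :
    ∃ k : ℕ, ∃ t ∈ Set.Ico (0 : ℝ) 1, x = (k + t) / 2 ^ n := by
  refine ⟨⌊x * 2 ^ n⌋₊, x * 2 ^ n - ⌊x * 2 ^ n⌋₊, ⟨?_, ?_⟩, ?_⟩
  · linarith [Nat.floor_le (mul_nonneg hx (by positivity : (0 : ℝ) ≤ 2 ^ n))]
  · linarith [Nat.lt_floor_add_one (x * 2 ^ n)]
  · field_simp
    ring

lemma abs_T_sub_sum_le (n : ℕ) {x : ℝ} (hx : 0 ≤ x) :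
    |T x - ∑ j ∈ Finset.range n, ((D j x : ℝ) ^ 2 - (D (j + 1) x : ℝ) ^ 2 + 3) / 2 ^ (j + 3)| ≤
      n ^ 1 / 2 ^ n + n ^ 0 / 2 ^ n := by
  obtain ⟨k, t, ht, rfl⟩ := exists_eq_add_div_two_pow n hx
  have hsum : ∑ j ∈ Finset.range n, ((D j ((k + t) / 2 ^ n) : ℝ) ^ 2 -
        (D (j + 1) ((k + t) / 2 ^ n) : ℝ) ^ 2 + 3) / 2 ^ (j + 3) =
      ∑ j ∈ Finset.range n, ((D j (k / 2 ^ n) : ℝ) ^ 2 -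
        (D (j + 1) (k / 2 ^ n) : ℝ) ^ 2 + 3) / 2 ^ (j + 3) := by
    refine Finset.sum_congr rfl fun j hj => ?_
    have := Finset.mem_range.1 hj
    rw [D_eq_of_le (by omega) k ht, D_eq_of_le (by omega) k ht]
  rw [hsum, T_expansion n k ht, add_sub_cancel_left, abs_div,
    abs_of_pos (by positivity : (0 : ℝ) < 2 ^ n), ← add_div]
  gcongr
  have hD : |(D n (k / 2 ^ n) : ℝ)| ≤ n := by exact_mod_cast abs_D_le n (k / 2 ^ n)
  have ht' : |t - 1 / 2| ≤ 1 := abs_le.2 ⟨by linarith [ht.1], by linarith [ht.2]⟩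
  calc |D n (k / 2 ^ n) * (t - 1 / 2) + T t|
      ≤ |(D n (k / 2 ^ n) : ℝ)| * |t - 1 / 2| + |T t| := by
        rw [← abs_mul]; exact abs_add_le _ _
    _ ≤ n * 1 + 1 := by
        gcongr
        rw [abs_of_nonneg (T_nonneg t)]
        exact T_le_one t
    _ = n ^ 1 + n ^ 0 := by simp

/-- `T` is constant on local level sets. -/
lemma T_eq_of_equivalent {x x' : ℝ} (hx : 0 ≤ x) (hx' : 0 ≤ x') (h : Equivalent x x') :
    T x = T x' := by
  have hlim : ∀ {z : ℝ}, 0 ≤ z → Filter.Tendsto (fun n : ℕ => ∑ j ∈ Finset.range n,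
      ((D j z : ℝ) ^ 2 - (D (j + 1) z : ℝ) ^ 2 + 3) / 2 ^ (j + 3)) Filter.atTop (nhds (T z)) := by
    intro z hz
    rw [tendsto_iff_dist_tendsto_zero]
    have h0 := (tendsto_pow_const_div_const_pow_of_one_lt 1 (one_lt_two (α := ℝ))).add
      (tendsto_pow_const_div_const_pow_of_one_lt 0 (one_lt_two (α := ℝ)))
    rw [add_zero] at h0
    refine squeeze_zero (fun n => dist_nonneg) (fun n => ?_) h0
    rw [dist_comm, Real.dist_eq]
    exact abs_T_sub_sum_le n hz
  have hsq : ∀ j, (D j x : ℝ) ^ 2 = (D j x' : ℝ) ^ 2 := by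
    intro j
    have := sq_eq_sq_iff_abs_eq_abs (D j x) (D j x') |>.2 (h j)
    exact_mod_cast this
  refine tendsto_nhds_unique (hlim hx) ?_
  simp only [hsq]
  exact hlim hx'

lemma localLevelSet_subset_levelSet {x : ℝ} (hx : x ∈ Set.Ico (0 : ℝ) 1) :
    localLevelSet x ⊆ levelSet (T x) := fun _ hz =>
  ⟨Set.Ico_subset_Icc_self hz.1, T_eq_of_equivalent hz.1.1 hx.1 hz.2⟩

/-! ### Humps -/

/-- A dyadic interval `[k / 2 ^ n, (k + 1) / 2 ^ n)` of `[0, 1)` whose `n` binary digits are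
balanced, that is, with as many zeros as ones. Over it, the graph of `T` is a similar copy (a hump)
of the whole graph; the number `n` is then automatically even. -/
structure Hump where
  /-- The number of digits. -/
  n : ℕ
  /-- The integer with these digits. -/
  k : ℕ
  lt : k < 2 ^ n
  balanced : D n (k / 2 ^ n) = 0

namespace Hump

instance : Countable Hump :=
  Function.Injective.countable (f := fun h : Hump => (h.n, h.k)) fun h g hg => by
    cases h; cases g; simp_all

/-- The similarity of `[0, 1)` onto the dyadic interval of the hump. -/
noncomputable def point (h : Hump) (t : ℝ) : ℝ := (h.k + t) / 2 ^ h.n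

/-- The dyadic interval of the hump. -/
def cell (h : Hump) : Set ℝ := h.point '' Set.Ico 0 1

/-- The closure of the dyadic interval of the hump. -/
def closedCell (h : Hump) : Set ℝ := h.point '' Set.Icc 0 1

/-- The set of values that `T` takes on the closed dyadic interval of the hump. -/
def levels (h : Hump) : Set ℝ :=
  Set.Icc (T (h.point 0)) (T (h.point 0) + 2 / 3 / 2 ^ h.n)

lemma point_mem_Ico (h : Hump) {t : ℝ} (ht : t ∈ Set.Ico (0 : ℝ) 1) :
    h.point t ∈ Set.Ico (0 : ℝ) 1 := by
  have h1 : (h.k : ℝ) + 1 ≤ 2 ^ h.n := by exact_mod_cast h.lt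
  have h0 : (0 : ℝ) ≤ h.k := Nat.cast_nonneg _
  refine ⟨div_nonneg (add_nonneg h0 ht.1) (by positivity), ?_⟩
  rw [point, div_lt_one (by positivity)]
  linarith [ht.2]

lemma cell_subset_closedCell (h : Hump) : h.cell ⊆ h.closedCell :=
  Set.image_mono Set.Ico_subset_Icc_self

lemma isCompact_closedCell (h : Hump) : IsCompact h.closedCell := by
  refine isCompact_Icc.image ?_
  unfold point
  fun_prop

lemma T_point (h : Hump) {t : ℝ} (ht : t ∈ Set.Ico (0 : ℝ) 1) :
    T (h.point t) = T (h.point 0) + T t / 2 ^ h.n := by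
  rw [point, point, T_expansion h.n h.k ht, T_expansion h.n h.k ⟨le_rfl, one_pos⟩, h.balanced,
    T_zero]
  simp

lemma D_add_point (h : Hump) (l : ℕ) {t : ℝ} (ht : t ∈ Set.Ico (0 : ℝ) 1) :
    D (h.n + l) (h.point t) = D l t := by
  rw [point, D_add h.n l h.k ht, h.balanced, zero_add]

lemma D_point_of_le (h : Hump) {j : ℕ} (hj : j ≤ h.n) {t : ℝ} (ht : t ∈ Set.Ico (0 : ℝ) 1) :
    D j (h.point t) = D j (h.k / 2 ^ h.n) :=
  D_eq_of_le hj h.k ht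

/-- The hump inside `h` that corresponds to `g` under the similarity `h.point`: its digits are
those of `h` followed by those of `g`. -/
def comp (h g : Hump) : Hump where
  n := h.n + g.n
  k := h.k * 2 ^ g.n + g.k
  lt := by
    calc h.k * 2 ^ g.n + g.k < h.k * 2 ^ g.n + 2 ^ g.n := by have := g.lt; omega
      _ = (h.k + 1) * 2 ^ g.n := by ring
      _ ≤ 2 ^ h.n * 2 ^ g.n := Nat.mul_le_mul_right _ h.lt
      _ = 2 ^ (h.n + g.n) := (pow_add 2 _ _).symm
  balanced := by
    have h0 := g.point_mem_Ico ⟨le_rfl, one_pos⟩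
    have h1 := h.D_add_point g.n h0
    rw [g.D_point_of_le le_rfl ⟨le_rfl, one_pos⟩, g.balanced] at h1
    rw [← h1]
    congr 1
    unfold point
    push_cast
    rw [pow_add]
    field_simp
    ring

lemma comp_point (h g : Hump) (t : ℝ) : (h.comp g).point t = h.point (g.point t) := by
  simp only [point, comp]
  push_cast
  rw [pow_add]
  field_simp
  ring

lemma T_comp_point_zero (h g : Hump) :
    T ((h.comp g).point 0) = T (h.point 0) + T (g.point 0) / 2 ^ h.n := by
  rw [comp_point, h.T_point (g.point_mem_Ico ⟨le_rfl, one_pos⟩)]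

lemma closedCell_comp_subset (h g : Hump) (hg : g.k + 1 < 2 ^ g.n) :
    (h.comp g).closedCell ⊆ h.cell := by
  rintro _ ⟨t, ht, rfl⟩
  refine ⟨g.point t, ⟨?_, ?_⟩, (comp_point h g t).symm⟩
  · exact div_nonneg (add_nonneg (Nat.cast_nonneg _) ht.1) (by positivity)
  · have : (g.k : ℝ) + 1 < 2 ^ g.n := by exact_mod_cast hg
    rw [point, div_lt_one (by positivity)]
    linarith [ht.2]

lemma cell_comp_subset (h g : Hump) : (h.comp g).cell ⊆ h.cell := by
  rintro _ ⟨t, ht, rfl⟩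
  exact ⟨g.point t, g.point_mem_Ico ht, (comp_point h g t).symm⟩

/-- The hump over all of `[0, 1)`, with the empty sequence of digits. -/
def unit : Hump where
  n := 0
  k := 0
  lt := by norm_num
  balanced := D_zero _

/-- The hump with digits `01`. -/
def short : Hump where
  n := 2
  k := 1
  lt := by norm_num
  balanced := by
    simp only [D, Finset.sum_range_succ, digits_val]
    norm_num

/-- The hump with digits `0011`. -/
def long : Hump where
  n := 4
  k := 3
  lt := by norm_num
  balanced := by
    simp only [D, Finset.sum_range_succ, digits_val]
    norm_num

lemma T_short : T (short.point 0) = 1 / 2 := by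
  rw [← T_one_quarter]
  norm_num [point, short]

lemma T_long : T (long.point 0) = 1 / 2 := by
  rw [← T_three_sixteenths]
  norm_num [point, long]

/-- Whatever digits follow, `01` and `0011` differ in the value of `D 2`. -/
lemma abs_D_ne_of_mem_cell (h : Hump) {x x' : ℝ} (hx : x ∈ (h.comp short).cell)
    (hx' : x' ∈ (h.comp long).cell) : |D (h.n + 2) x| ≠ |D (h.n + 2) x'| := by
  obtain ⟨t, ht, rfl⟩ := hx
  obtain ⟨t', ht', rfl⟩ := hx'
  rw [comp_point, comp_point, h.D_add_point 2 (short.point_mem_Ico ht),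
    h.D_add_point 2 (long.point_mem_Ico ht'), short.D_point_of_le (j := 2) le_rfl ht,
    long.D_point_of_le (j := 2) (by norm_num [long]) ht']
  simp only [D, Finset.sum_range_succ, digits_val, short, long]
  norm_num

/-- The interior of the common part of the ranges of `T` on the humps `h.comp short` and
`h.comp long`. -/
def core (h : Hump) : Set ℝ :=
  Set.Ioo (T (h.point 0) + 1 / 2 / 2 ^ h.n) (T (h.point 0) + 13 / 24 / 2 ^ h.n)

lemma core_subset_levels_short (h : Hump) : h.core ⊆ (h.comp short).levels := by
  rintro y ⟨h1, h2⟩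
  have hp : (0 : ℝ) < (2 ^ h.n)⁻¹ := by positivity
  rw [levels, T_comp_point_zero, T_short, show (h.comp short).n = h.n + 2 from rfl, pow_add]
  simp only [Set.mem_Icc, div_eq_mul_inv, mul_inv] at h1 h2 ⊢
  norm_num at h1 h2 ⊢
  constructor <;> linarith

lemma core_subset_levels_long (h : Hump) : h.core ⊆ (h.comp long).levels := by
  rintro y ⟨h1, h2⟩
  have hp : (0 : ℝ) < (2 ^ h.n)⁻¹ := by positivity
  rw [levels, T_comp_point_zero, T_long, show (h.comp long).n = h.n + 4 from rfl, pow_add]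
  simp only [Set.mem_Icc, div_eq_mul_inv, mul_inv] at h1 h2 ⊢
  norm_num at h1 h2 ⊢
  constructor <;> linarith

end Hump

/-! ### Density of the cores -/

lemma D_succ_add (n : ℕ) (e k : ℕ) (hk : k < 2 ^ n) :
    D (n + 1) (((e * 2 ^ n + k : ℕ) : ℝ) / 2 ^ (n + 1)) = D 1 (e / 2) + D n (k / 2 ^ n) := by
  have ht : (k : ℝ) / 2 ^ n ∈ Set.Ico (0 : ℝ) 1 :=
    ⟨by positivity, by rw [div_lt_one (by positivity)]; exact_mod_cast hk⟩
  have := D_add 1 n e ht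
  rw [pow_one, add_comm 1 n] at this
  rw [← this]
  congr 1
  push_cast
  rw [pow_succ]
  field_simp

/-- Flipping all digits changes the sign of `D n`. -/
lemma exists_D_eq_neg (n k : ℕ) (hk : k < 2 ^ n) :
    ∃ k' : ℕ, k' < 2 ^ n ∧ D n ((k' : ℝ) / 2 ^ n) = -D n ((k : ℝ) / 2 ^ n) := by
  induction n generalizing k with
  | zero => exact ⟨0, by norm_num, by simp [D_zero]⟩
  | succ n ih =>
    obtain ⟨q, e, he, hq, rfl⟩ : ∃ q e : ℕ, e < 2 ∧ q < 2 ^ n ∧ k = e * 2 ^ n + q :=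
      ⟨k % 2 ^ n, k / 2 ^ n, Nat.div_lt_of_lt_mul (by rwa [← pow_succ]),
        Nat.mod_lt _ (by positivity), (Nat.div_add_mod' k (2 ^ n)).symm⟩
    obtain ⟨q', hq', hD⟩ := ih q hq
    refine ⟨(1 - e) * 2 ^ n + q', ?_, ?_⟩
    · interval_cases e <;> omega
    · rw [D_succ_add n _ q' hq', D_succ_add n _ _ hq, hD]
      interval_cases e
      · rw [D_one_of_le (by norm_num) (by norm_num), D_one_of_lt (by norm_num)]
        ring
      · rw [D_one_of_lt (by norm_num), D_one_of_le (by norm_num) (by norm_num)]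
        ring

/-- Any finite sequence of `n` digits can be completed to a balanced one of length `2 * n`. -/
lemma exists_hump_abs_sub_le (n : ℕ) {x : ℝ} (hx : x ∈ Set.Ico (0 : ℝ) 1) :
    ∃ h : Hump, h.n = n + n ∧ |h.point 0 - x| ≤ (1 / 2) ^ n := by
  obtain ⟨k, t, ht, rfl⟩ := exists_eq_add_div_two_pow n hx.1
  have hk : k < 2 ^ n := by
    have h1 := hx.2
    rw [div_lt_one (by positivity)] at h1
    exact_mod_cast lt_of_le_of_lt (le_add_of_nonneg_right ht.1) h1
  obtain ⟨k', hk', hD⟩ := exists_D_eq_neg n k hk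
  have ht' : (k' : ℝ) / 2 ^ n ∈ Set.Ico (0 : ℝ) 1 :=
    ⟨by positivity, by rw [div_lt_one (by positivity)]; exact_mod_cast hk'⟩
  have hpt : ((k * 2 ^ n + k' : ℕ) : ℝ) / 2 ^ (n + n) = (k + k' / 2 ^ n) / 2 ^ n := by
    push_cast
    rw [pow_add]
    field_simp
  refine ⟨⟨n + n, k * 2 ^ n + k', ?_, ?_⟩, rfl, ?_⟩
  · calc k * 2 ^ n + k' < k * 2 ^ n + 2 ^ n := by omega
      _ = (k + 1) * 2 ^ n := by ring
      _ ≤ 2 ^ n * 2 ^ n := Nat.mul_le_mul_right _ hk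
      _ = 2 ^ (n + n) := (pow_add 2 _ _).symm
  · rw [hpt, D_add n n k ht', hD, add_neg_cancel]
  · rw [Hump.point, add_zero, hpt, ← sub_div, add_sub_add_left_eq_sub, abs_div,
      abs_of_pos (by positivity : (0 : ℝ) < 2 ^ n), one_div_pow]
    gcongr
    exact abs_le.2 ⟨by linarith [ht.2, ht'.1], by linarith [ht.1, ht'.2]⟩

/-- Humps of arbitrarily small range occur near every value of `T`, because balanced dyadic
rationals are dense and `T` is continuous. -/
lemma exists_hump_levels_subset {U : Set ℝ} (hU : IsOpen U) {t : ℝ}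
    (ht : t ∈ Set.Ico (0 : ℝ) 1) (htU : T t ∈ U) : ∃ h : Hump, h.levels ⊆ U := by
  choose h hn hh using fun n => exists_hump_abs_sub_le n ht
  have hpow : Filter.Tendsto (fun n : ℕ => (1 / 2 : ℝ) ^ n) Filter.atTop (nhds 0) :=
    tendsto_pow_atTop_nhds_zero_of_lt_one (by norm_num) (by norm_num)
  have hpt : Filter.Tendsto (fun n => (h n).point 0) Filter.atTop (nhds t) := by
    rw [tendsto_iff_dist_tendsto_zero]
    exact squeeze_zero (fun _ => dist_nonneg) hh hpow
  have hT := (continuous_T.tendsto t).comp hpt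
  have hlen : Filter.Tendsto (fun n => 2 / 3 / 2 ^ (h n).n : ℕ → ℝ) Filter.atTop (nhds 0) := by
    have := (hpow.mul hpow).const_mul (2 / 3)
    rw [mul_zero, mul_zero] at this
    refine this.congr fun n => ?_
    rw [hn, ← pow_add, one_div_pow, mul_one_div]
  have htop := hT.add hlen
  rw [add_zero] at htop
  obtain ⟨n, hnU⟩ := (hT.Icc htop |>.eventually (Filter.eventually_smallSets_subset.2
    (hU.mem_nhds htU))).exists
  exact ⟨h n, hnU⟩

/-- The levels `y` that, if taken on the hump `h`, are also taken in the core of a hump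
inside `h`. -/
def splitting (h : Hump) : Set ℝ := h.levelsᶜ ∪ ⋃ g : Hump, (h.comp g).core

lemma isOpen_splitting (h : Hump) : IsOpen (splitting h) :=
  isClosed_Icc.isOpen_compl.union (isOpen_iUnion fun _ => isOpen_Ioo)

lemma dense_splitting (h : Hump) : Dense (splitting h) := by
  rw [dense_iff_inter_open]
  rintro U hU ⟨y, hyU⟩
  by_cases hUh : U ⊆ h.levels
  · have hp : (0 : ℝ) < 2 ^ h.n := by positivity
    have hy := hUh hyU
    obtain ⟨t, ht, hTt⟩ := exists_T_eq (y := (y - T (h.point 0)) * 2 ^ h.n)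
      ⟨mul_nonneg (by linarith [hy.1]) hp.le, by
        rw [← le_div_iff₀ hp]; linarith [hy.2]⟩
    have hcont : Continuous fun s : ℝ => T (h.point 0) + s / 2 ^ h.n := by fun_prop
    obtain ⟨g, hg⟩ := exists_hump_levels_subset (hU.preimage hcont) ht (by
      rw [hTt, Set.mem_preimage, mul_div_cancel_right₀ _ hp.ne', add_sub_cancel]
      exact hyU)
    have hq : (0 : ℝ) < (2 ^ g.n)⁻¹ := by positivity
    have hr : (0 : ℝ) < (2 ^ h.n)⁻¹ * (2 ^ g.n)⁻¹ := by positivity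
    -- `25 / 48` is the midpoint of `1 / 2` and `13 / 24`.
    refine ⟨T (h.point 0) + (T (g.point 0) + 25 / 48 / 2 ^ g.n) / 2 ^ h.n,
      hg ⟨?_, ?_⟩, Or.inr (Set.mem_iUnion.2 ⟨g, ?_⟩)⟩
    · simp only [div_eq_mul_inv]
      linarith
    · simp only [div_eq_mul_inv]
      linarith
    · rw [Hump.core, Hump.T_comp_point_zero, show (h.comp g).n = h.n + g.n from rfl, pow_add]
      simp only [Set.mem_Ioo, div_eq_mul_inv, mul_inv, add_mul]
      constructor <;> linarith
  · obtain ⟨z, hzU, hz⟩ := Set.not_subset.1 hUh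
    exact ⟨z, hzU, Or.inl hz⟩

/-! ### Uncountably many local level sets -/

/-- Of the two humps inside `h` that share the level `y`, at least one contains no point equivalent
to `z`. -/
lemma exists_hump_avoiding {y : ℝ} (hy : ∀ h : Hump, y ∈ splitting h) (z : ℝ) (h : Hump)
    (hyh : y ∈ h.levels) :
    ∃ g : Hump, y ∈ g.levels ∧ h.n < g.n ∧ g.closedCell ⊆ h.cell ∧
      ∀ x ∈ g.cell, ¬ Equivalent x z := by
  obtain hyh' | hyg := hy h
  · exact absurd hyh hyh'
  obtain ⟨g, hg⟩ := Set.mem_iUnion.1 hyg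
  by_cases hz : ∃ x ∈ ((h.comp g).comp Hump.short).cell, Equivalent x z
  · obtain ⟨x, hx, hxz⟩ := hz
    refine ⟨(h.comp g).comp Hump.long, Hump.core_subset_levels_long _ hg, ?_,
      (Hump.closedCell_comp_subset _ _ (by norm_num [Hump.long])).trans
        (Hump.cell_comp_subset h g), fun x' hx' hxz' => ?_⟩
    · simp only [Hump.comp, Hump.long]
      omega
    · exact (h.comp g).abs_D_ne_of_mem_cell hx hx' ((hxz _).trans (hxz' _).symm)
  · push Not at hz
    refine ⟨(h.comp g).comp Hump.short, Hump.core_subset_levels_short _ hg, ?_,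
      (Hump.closedCell_comp_subset _ _ (by norm_num [Hump.short])).trans
        (Hump.cell_comp_subset h g), hz⟩
    simp only [Hump.comp, Hump.short]
    omega

/-- Diagonal argument: for any sequence of points, the level `y` contains a point equivalent to
none of them. -/
lemma exists_T_eq_forall_not_equivalent {y : ℝ} (hy0 : y ∈ Set.Icc (0 : ℝ) (2 / 3))
    (hy : ∀ h : Hump, y ∈ splitting h) (z : ℕ → ℝ) :
    ∃ x ∈ Set.Ico (0 : ℝ) 1, T x = y ∧ ∀ i, ¬ Equivalent x (z i) := by
  choose! next hlev hn hsub havoid using exists_hump_avoiding hy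
  let s : ℕ → Hump := fun i => Nat.rec Hump.unit (fun i h => next (z i) h) i
  have hs : ∀ i, s (i + 1) = next (z i) (s i) := fun _ => rfl
  have hslev : ∀ i, y ∈ (s i).levels := by
    intro i
    induction i with
    | zero =>
      change y ∈ Hump.unit.levels
      simpa [Hump.levels, Hump.point, Hump.unit, T_zero] using hy0
    | succ i ih => exact hlev _ _ ih
  have hsn : ∀ i, i ≤ (s i).n := by
    intro i
    induction i with
    | zero => exact Nat.zero_le _
    | succ i ih => exact ih.trans_lt (hn (z i) (s i) (hslev i))
  have hssub : ∀ i, (s (i + 1)).closedCell ⊆ (s i).cell := fun i => hsub _ _ (hslev i)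
  obtain ⟨x, hx⟩ := IsCompact.nonempty_iInter_of_sequence_nonempty_isCompact_isClosed
    (fun i => (s i).closedCell)
    (fun i => (hssub i).trans (s i).cell_subset_closedCell)
    (fun i => ⟨_, 0, ⟨le_rfl, zero_le_one⟩, rfl⟩)
    (s 0).isCompact_closedCell (fun i => (s i).isCompact_closedCell.isClosed)
  have hxs : ∀ i, x ∈ (s i).cell := fun i => hssub i (Set.mem_iInter.1 hx (i + 1))
  refine ⟨x, ?_, ?_, fun i => havoid (z i) (s i) (hslev i) x (hxs (i + 1))⟩
  · obtain ⟨t, ht, rfl⟩ := hxs 0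
    exact (s 0).point_mem_Ico ht
  · have hpow : Filter.Tendsto (fun n : ℕ => (1 / 2 : ℝ) ^ n) Filter.atTop (nhds 0) :=
      tendsto_pow_atTop_nhds_zero_of_lt_one (by norm_num) (by norm_num)
    have hle : ∀ i, |T x - y| ≤ (1 / 2 : ℝ) ^ i := by
      intro i
      obtain ⟨t, ht, hxt⟩ := hxs i
      have h1 : (1 / 2 : ℝ) ^ (s i).n ≤ (1 / 2) ^ i :=
        pow_le_pow_of_le_one (by norm_num) (by norm_num) (hsn i)
      refine le_trans ?_ h1
      have hlev' := hslev i
      rw [← hxt, (s i).T_point ht]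
      have hp : (0 : ℝ) < (1 / 2) ^ (s i).n := by positivity
      have hT0 := mul_nonneg (T_nonneg t) hp.le
      have hT1 := mul_le_mul_of_nonneg_right (T_le t) hp.le
      have hdiv : ∀ a : ℝ, a / 2 ^ (s i).n = a * (1 / 2) ^ (s i).n := fun a => by
        rw [one_div_pow, mul_one_div]
      simp only [Hump.levels, Set.mem_Icc, hdiv] at hlev' ⊢
      exact abs_le.2 ⟨by linarith [hlev'.2], by linarith [hlev'.1]⟩
    have h0 := ge_of_tendsto' hpow hle
    exact sub_eq_zero.1 (abs_nonpos_iff.1 h0)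

lemma mem_SLocUc {y : ℝ} (hy0 : y ∈ Set.Icc (0 : ℝ) (2 / 3))
    (hy : ∀ h : Hump, y ∈ splitting h) : y ∈ SLocUc := by
  intro hcount
  obtain ⟨f, hf⟩ := Set.countable_iff_exists_subset_range.1 hcount
  have hrep : ∀ i, ∃ z, (∃ x, f i = localLevelSet x) → f i = localLevelSet z := by
    intro i
    by_cases h : ∃ x, f i = localLevelSet x
    · exact ⟨h.choose, fun _ => h.choose_spec⟩
    · exact ⟨0, fun h' => absurd h' h⟩
  choose z hz using hrep
  obtain ⟨x, hx, rfl, hne⟩ := exists_T_eq_forall_not_equivalent hy0 hy z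
  obtain ⟨i, hi⟩ := hf ⟨⟨x, hx, rfl⟩, localLevelSet_subset_levelSet hx⟩
  have hmem : x ∈ localLevelSet x := ⟨hx, fun _ => rfl⟩
  rw [← hi, hz i ⟨x, hi⟩] at hmem
  exact hne i hmem.2

/-- A dense set need not meet a closed set densely, but a nondegenerate closed interval is the
closure of its interior. -/
lemma dense_preimage_coe_Icc {a b : ℝ} (hab : a < b) {G : Set ℝ} (hG : Dense G) :
    Dense ((↑) ⁻¹' G : Set (Set.Icc a b)) := by
  rw [Subtype.dense_iff, Subtype.image_preimage_coe]
  calc Set.Icc a b = closure (Set.Ioo a b) := (closure_Ioo hab.ne).symm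
    _ ⊆ closure (Set.Ioo a b ∩ G) :=
        closure_minimal (hG.open_subset_closure_inter isOpen_Ioo) isClosed_closure
    _ ⊆ closure (Set.Icc a b ∩ G) :=
        closure_mono (Set.inter_subset_inter_left _ Set.Ioo_subset_Icc_self)

lemma SLocUc_mem_residual :
    {y : Set.Icc (0 : ℝ) (2 / 3) | (y : ℝ) ∈ SLocUc} ∈ residual (Set.Icc (0 : ℝ) (2 / 3)) := by
  have hres : ∀ h : Hump, ((↑) ⁻¹' splitting h : Set (Set.Icc (0 : ℝ) (2 / 3))) ∈ residual _ :=
    fun h => residual_of_dense_open ((isOpen_splitting h).preimage continuous_subtype_val)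
      (dense_preimage_coe_Icc (by norm_num) (dense_splitting h))
  filter_upwards [countable_iInter_mem.2 hres] with y hy
  exact mem_SLocUc y.2 fun h => Set.mem_iInter.1 hy h

end Takagi

theorem theorem8 :
    Takagi.rangeT = Set.Icc (0 : ℝ) (2 / 3) ∧
      {y : Takagi.rangeT | (y : ℝ) ∈ Takagi.SLocUc} ∈ residual Takagi.rangeT := by
  refine ⟨Takagi.rangeT_eq, ?_⟩
  rw [Takagi.rangeT_eq]
  exact Takagi.SLocUc_mem_residual
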